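/- Let $n\ge 2$ be an integer and let $\lambda>L>0$, $v_{\max}>0$, $v^*\in(0,v_{\max})$, $\mu>0$ be constants. Let $V\in C^3((L,+\infty);[0,+\infty))$ satisfy $\lim_{x\to L^+}V(x)=+\infty$, $V(x)=0$ for $x\ge\lambda$, and $V'(x)<0$, $V''(x)>0$ for $x\in(L,\lambda)$. Let $b:\mathbb{R}\to(v^*-v_{\max},v^*)$ be $C^2$ and non-decreasing with $b(0)=0$, $x\,b(x)>0$ for $x\ne0$ and $b'(0)>0$. Consider the open set $$\Omega_S=\{(s_2,\dots,s_n,v_1,\dots,v_n)\in\mathbb{R}^{2n-1}:\ s_i>L\ (i=2,\dots,n),\ 0<v_i<v_{\max}\ (i=1,\dots,n)\}$$ and, with the convention $V'(s_1)=V''(s_1)=V'(s_{n+1})=V''(s_{n+1})=0$ (so that $v_0$ and $v_{n+1}$ below are immaterial), define for $(s,v)\in\Omega_S$ and $i=1,\dots,n$ $$f_i(s)=v^*-b\big(V'(s_{i+1})-V'(s_i)\big),\qquad \beta(v,y)=\frac{v_{\max}^3(v+y)-2v_{\max}^2yv}{2(v_{\max}-v)^2v^2},$$ $$Z_i(s,v)=-v_{\max}^2\,b'\big(V'(s_{i+1})-V'(s_i)\big)\Big(V''(s_{i+1})(v_i-v_{i+1})-V''(s_i)(v_{i-1}-v_i)\Big),$$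 $$F_i(s,v)=\frac{1}{\beta(v_i,f_i(s))}\left(\frac{Z_i(s,v)-\mu v_{\max}^2(v_i-f_i(s))}{v_i(v_{\max}-v_i)}+V'(s_i)-V'(s_{i+1})\right).$$ Consider the closed-loop system on $\Omega_S$ $$\dot s_i=v_{i-1}-v_i\quad(i=2,\dots,n),\qquad \dot v_i=F_i(s,v)\quad(i=1,\dots,n).$$ Then for every compact set $S\subset\Omega_S$ there exists a compact set $K\subset\Omega_S$ such that every solution with $(s(0),v(0))\in S$ satisfies $(s(t),v(t))\in K$ for all $t\ge0$. That is, for every $T\in(0,+\infty]$, every solution on $[0,T)$ with values in $\Omega_S$ and $(s(0),v(0))\in S$ satisfies $(s(t),v(t))\in K$ for all $t\in[0,T)$, and if it is maximal (has no extension to a solution on a longer interval $[0,T')$), then $T=+\infty$. -/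

import Mathlib

open Set Filter Topology

noncomputable section

namespace CruiseControl

/-- The data of the open-road cruise-control problem: number of vehicles `n`, safety distance `L`,
interaction distance `lam`, speed limit `vmax`, desired speed `vstar`, gain `mu`, potential `V`
(only its values on `(L, ∞)` matter) and the function `b`. -/
structure Params where
  n : ℕ
  L : ℝ
  lam : ℝ
  vmax : ℝ
  vstar : ℝ
  mu : ℝ
  V : ℝ → ℝ
  b : ℝ → ℝ

/-- The standing assumptions on the data. -/
structure Params.Admissible (P : Params) : Prop where
  two_le_n : 2 ≤ P.n
  L_pos : 0 < P.L
  L_lt_lam : P.L < P.lam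
  vstar_pos : 0 < P.vstar
  vstar_lt_vmax : P.vstar < P.vmax
  mu_pos : 0 < P.mu
  V_contDiffOn : ContDiffOn ℝ 3 P.V (Ioi P.L)
  V_nonneg : ∀ x, P.L < x → 0 ≤ P.V x
  V_tendsto : Tendsto P.V (𝓝[>] P.L) atTop
  V_eq_zero : ∀ x, P.lam ≤ x → P.V x = 0
  V_deriv_neg : ∀ x ∈ Ioo P.L P.lam, deriv P.V x < 0
  V_deriv2_pos : ∀ x ∈ Ioo P.L P.lam, 0 < deriv (deriv P.V) x
  b_contDiff : ContDiff ℝ 2 P.b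
  b_mem : ∀ x, P.b x ∈ Ioo (P.vstar - P.vmax) P.vstar
  b_mono : Monotone P.b
  b_zero : P.b 0 = 0
  b_sign : ∀ x, x ≠ 0 → 0 < x * P.b x
  b_deriv_zero_pos : 0 < deriv P.b 0

namespace Params

variable (P : Params)

/-- States `(s, v)` with `s = (s_2, …, s_n)` and `v = (v_1, …, v_n)`, that is, `ℝ^(2n-1)`. -/
abbrev State : Type := (↥(Finset.Icc 2 P.n) → ℝ) × (↥(Finset.Icc 1 P.n) → ℝ)

/-- The open-road state space. -/
def OmegaS : Set P.State :=
  {x | (∀ i, P.L < x.1 i) ∧ (∀ i, x.2 i < P.vmax) ∧ (∀ i, 0 < x.2 i)}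

/-- `V'(s_i)`, with the convention `V'(s_1) = V'(s_{n+1}) = 0`. -/
def dV (x : P.State) (i : ℕ) : ℝ :=
  if h : i ∈ Finset.Icc 2 P.n then deriv P.V (x.1 ⟨i, h⟩) else 0

/-- `V''(s_i)`, with the convention `V''(s_1) = V''(s_{n+1}) = 0`. -/
def ddV (x : P.State) (i : ℕ) : ℝ :=
  if h : i ∈ Finset.Icc 2 P.n then deriv (deriv P.V) (x.1 ⟨i, h⟩) else 0

/-- The speed `v_i`. The values for `i = 0` and `i = n + 1` are immaterial: they occur
only multiplied by `V''(s_1) = 0` and `V''(s_{n+1}) = 0`. -/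
def vel (x : P.State) (i : ℕ) : ℝ :=
  if h : i ∈ Finset.Icc 1 P.n then x.2 ⟨i, h⟩ else 0

/-- The spacing-dependent desired speed `f_i(s)`. -/
def f (x : P.State) (i : ℕ) : ℝ :=
  P.vstar - P.b (P.dV x (i + 1) - P.dV x i)

/-- `β(v, y)`. -/
def beta (v y : ℝ) : ℝ :=
  (P.vmax ^ 3 * (v + y) - 2 * P.vmax ^ 2 * y * v) / (2 * (P.vmax - v) ^ 2 * v ^ 2)

/-- The viscosity term `Z_i(s, v)`. -/
def Z (x : P.State) (i : ℕ) : ℝ :=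
  -P.vmax ^ 2 * deriv P.b (P.dV x (i + 1) - P.dV x i) *
    (P.ddV x (i + 1) * (P.vel x i - P.vel x (i + 1)) -
      P.ddV x i * (P.vel x (i - 1) - P.vel x i))

/-- The feedback law: the acceleration `F_i(s, v)` of vehicle `i`, for `1 ≤ i ≤ n`. -/
def F (x : P.State) (i : ℕ) : ℝ :=
  1 / P.beta (P.vel x i) (P.f x i) *
    ((P.Z x i - P.mu * P.vmax ^ 2 * (P.vel x i - P.f x i)) /
        (P.vel x i * (P.vmax - P.vel x i)) +
      P.dV x i - P.dV x (i + 1))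

/-- The time interval `[0, T)`, where `T` may be `+∞`. -/
def timeInterval (T : EReal) : Set ℝ := {t | 0 ≤ t ∧ (t : EReal) < T}

/-- `x` is a solution, with values in the state space, of the closed-loop system on `[0, T)`,
`0 < T ≤ +∞` (the derivative at `0` is one-sided). -/
structure IsSolution (T : EReal) (x : ℝ → P.State) : Prop where
  T_pos : 0 < T
  mem : ∀ t ∈ timeInterval T, x t ∈ P.OmegaS
  deriv_s : ∀ t ∈ timeInterval T, ∀ i : ↥(Finset.Icc 2 P.n),
    HasDerivWithinAt (fun τ => (x τ).1 i) (P.vel (x t) (i - 1) - P.vel (x t) i)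
      (timeInterval T) t
  deriv_v : ∀ t ∈ timeInterval T, ∀ i : ↥(Finset.Icc 1 P.n),
    HasDerivWithinAt (fun τ => (x τ).2 i) (P.F (x t) i) (timeInterval T) t

/-- `x` is a maximal solution: it has no extension to a solution on a longer interval `[0, T')`. -/
def IsMaximalSolution (T : EReal) (x : ℝ → P.State) : Prop :=
  P.IsSolution T x ∧
    ∀ (T' : EReal) (y : ℝ → P.State), T < T' → P.IsSolution T' y → ¬ EqOn y x (timeInterval T)

end Params

end CruiseControl

end

/-! The total energy, kinetic terms vmax²(v_i - f_i)²/(2(vmax - v_i)v_i) plus potentials V(s_i), is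
a Lyapunov function. The factor `beta` and the term `Z` are what differentiating the kinetic part
produces, so along solutions only damping, force terms and V'(s_i)(v_{i-1} - v_i) remain. Summation
by parts cancels the force terms up to -d b(d) ≤ 0, where d = V'(s_{i+1}) - V'(s_i)
(`energy_le_energy_zero`). Since V blows up at L, bounded energy keeps every spacing away from L.

The energy does not bound spacings from above, because V vanishes beyond lam. There the kinetic
energy is split into over-speed and under-speed halves. While s_i > lam, vehicles i - 1 and i do not
interact: the force on i - 1 can only brake, that on i can only accelerate, and f_{i-1} ≤ f_i. So
the over-speed of i - 1 and the under-speed of i decay exponentially (`max_le_exp`), the relative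
speed has an integrable bound, and s_i grows by at most a constant (`spacing_le`).

With spacings in a compact interval, V' is bounded, the desired speeds stay away from 0 and vmax,
and the kinetic energy then keeps the speeds away from 0 and vmax (`exists_box`). A solution
confined to a compact set can be continued, so a maximal one is global. -/

/-! ### Continuation of solutions that stay in a compact set. -/

theorem UniformContinuousOn.cauchy_map {α β : Type*} [UniformSpace α] [UniformSpace β]
    {f : α → β} {s : Set α} (hf : UniformContinuousOn f s) {l : Filter α} (hl : Cauchy l)
    (hs : s ∈ l) : Cauchy (l.map f) := by
  have := hl.1
  refine ⟨inferInstance, ?_⟩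
  rw [Filter.prod_map_map_eq]
  refine (Filter.map_mono ?_).trans hf
  exact le_inf hl.2 (le_principal_iff.2 (prod_mem_prod hs hs))

/-- A solution of an autonomous `C¹` equation on `[0, T)` that stays in a compact subset of the
domain extends beyond `T`. -/
theorem exists_extension_of_mem_compact {E : Type*} [NormedAddCommGroup E] [NormedSpace ℝ E]
    [CompleteSpace E] {U K : Set E} (hU : IsOpen U) {G : E → E} (hG : ContDiffOn ℝ 1 G U)
    (hK : IsCompact K) (hKU : K ⊆ U) {T : ℝ} (hT : 0 < T) {x : ℝ → E}
    (hx : ∀ t ∈ Ico 0 T, HasDerivWithinAt x (G (x t)) (Ico 0 T) t)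
    (hxK : ∀ t ∈ Ico 0 T, x t ∈ K) :
    ∃ T' > T, ∃ y : ℝ → E, EqOn y x (Ico 0 T) ∧
      ∀ t ∈ Ico 0 T', y t ∈ U ∧ HasDerivWithinAt y (G (y t)) (Ico 0 T') t := by
  have hGK : ContinuousOn G K := hG.continuousOn.mono hKU
  obtain ⟨C, hC⟩ := hK.exists_bound_of_continuousOn hGK
  -- The field is bounded on `K`, so `x` is Lipschitz and converges to a point of `K` at `T`.
  have hunif : UniformContinuousOn x (Ico 0 T) := by
    have hlip : LipschitzOnWith (Real.toNNReal C) x (Ico 0 T) := by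
      refine LipschitzOnWith.of_dist_le_mul fun s hs t ht => ?_
      rw [dist_eq_norm, dist_eq_norm]
      refine ((convex_Ico 0 T).norm_image_sub_le_of_norm_hasDerivWithin_le hx
        (fun τ hτ => hC _ (hxK τ hτ)) ht hs).trans ?_
      gcongr
      exact Real.le_coe_toNNReal C
    exact hlip.uniformContinuousOn
  have hmem : Ico 0 T ∈ 𝓝[<] T := Ico_mem_nhdsLT hT
  obtain ⟨xT, hxT, hlim⟩ := hK.isComplete _
    (hunif.cauchy_map (cauchy_nhds.mono nhdsWithin_le_nhds) hmem)
    (by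
      rw [le_principal_iff]
      exact Filter.mem_map.2 (mem_of_superset hmem hxK))
  replace hlim : Tendsto x (𝓝[<] T) (𝓝 xT) := hlim
  obtain ⟨z, hzT, r, hr, hz⟩ := (hG.contDiffAt (hU.mem_nhds
    (hKU hxT))).exists_forall_mem_closedBall_exists_eq_forall_mem_Ioo_hasDerivAt₀ T
  replace hz : ∀ᶠ t in 𝓝 T, HasDerivAt z (G (z t)) t :=
    mem_of_superset (Ioo_mem_nhds (by linarith) (by linarith)) hz
  have hzU : ∀ᶠ t in 𝓝 T, z t ∈ U := by
    have := hz.self_of_nhds.continuousAt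
    exact this.eventually_mem (hU.mem_nhds (by rw [hzT]; exact hKU hxT))
  obtain ⟨ε, hε, hball⟩ := Metric.eventually_nhds_iff.1 (hz.and hzU)
  let y : ℝ → E := fun t => if t < T then x t else z t
  have hyx : EqOn y x (Iio T) := fun t ht => if_pos ht
  have hyz : EqOn y z (Ici T) := fun t ht => if_neg (not_lt.2 ht)
  have hyT : y T = xT := by rw [hyz self_mem_Ici, hzT]
  have hxd : ∀ t ∈ Ioo 0 T, HasDerivAt x (G (x t)) t := fun t ht =>
    (hx t (Ioo_subset_Ico_self ht)).hasDerivAt (Ico_mem_nhds ht.1 ht.2)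
  have hyd : ∀ t ∈ Ioo 0 T, HasDerivAt y (G (y t)) t := fun t ht => by
    rw [hyx ht.2]
    exact (hxd t ht).congr_of_eventuallyEq (hyx.eventuallyEq_of_mem (Iio_mem_nhds ht.2))
  refine ⟨T + ε, by linarith, y, hyx.mono fun t ht => ht.2, fun t ht => ?_⟩
  rcases lt_trichotomy t T with h | h | h
  · have htI : t ∈ Ico 0 T := ⟨ht.1, h⟩
    rw [hyx h]
    refine ⟨hKU (hxK t htI), ?_⟩
    have h1 : HasDerivWithinAt x (G (x t)) (Ico 0 (T + ε)) t := by
      refine (hx t htI).mono_of_mem_nhdsWithin ?_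
      filter_upwards [self_mem_nhdsWithin, mem_nhdsWithin_of_mem_nhds (Iio_mem_nhds h)] with s hs hs'
      exact ⟨hs.1, hs'⟩
    exact h1.congr_of_eventuallyEq
      (mem_nhdsWithin_of_mem_nhds (mem_of_superset (Iio_mem_nhds h) hyx)) (hyx h)
  · subst h
    refine ⟨by rw [hyT]; exact hKU hxT, ?_⟩
    have hlimy : Tendsto y (𝓝[<] t) (𝓝 xT) :=
      hlim.congr' (mem_of_superset self_mem_nhdsWithin fun s hs => (hyx hs).symm)
    -- The left derivative at the junction is the limit of the derivatives before it.
    have hleft : HasDerivWithinAt y (G (y t)) (Iic t) t := by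
      refine hasDerivWithinAt_Iic_of_tendsto_deriv (s := Ioo 0 t)
        (fun s hs => (hyd s hs).differentiableAt.differentiableWithinAt) ?_
        (Ioo_mem_nhdsLT hT) ?_
      · unfold ContinuousWithinAt
        rw [hyT]
        exact hlimy.mono_left (nhdsWithin_mono _ fun s hs => hs.2)
      · have hcont : Tendsto (fun s => G (y s)) (𝓝[<] t) (𝓝 (G (y t))) := by
          rw [hyT]
          exact (hG.continuousOn.continuousAt (hU.mem_nhds (hKU hxT))).tendsto.comp hlimy
        refine hcont.congr' ?_
        filter_upwards [Ioo_mem_nhdsLT hT] with s hs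
        exact (hyd s hs).deriv.symm
    have hright : HasDerivWithinAt y (G (y t)) (Ici t) t := by
      rw [hyT, ← hzT]
      exact (hz.self_of_nhds.hasDerivWithinAt).congr hyz (hyz self_mem_Ici)
    have := hleft.union hright
    rw [Iic_union_Ici] at this
    exact this.mono (subset_univ _)
  · have hb := hball (y := t) (by rw [Real.dist_eq, abs_of_pos (sub_pos.2 h)]; linarith [ht.2])
    rw [hyz h.le]
    refine ⟨hb.2, HasDerivAt.hasDerivWithinAt ?_⟩
    exact hb.1.congr_of_eventuallyEq (mem_of_superset (Ioi_mem_nhds h) fun s hs => hyz (mem_Ioi.1 hs).le)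

/-! ### Energy of a single vehicle. -/

noncomputable section

/-- Squaring removes the corner of the positive part, so each half of the kinetic energy can be
differentiated on its own. -/
theorem hasDerivAt_max_zero_sq (r : ℝ) :
    HasDerivAt (fun r : ℝ => max r 0 ^ 2) (2 * max r 0) r := by
  rcases lt_trichotomy r 0 with h | h | h
  · rw [max_eq_right h.le, mul_zero]
    refine (hasDerivAt_const r (0 : ℝ)).congr_of_eventuallyEq ?_
    filter_upwards [Iio_mem_nhds h] with s hs
    rw [max_eq_right (le_of_lt hs)]
    norm_num
  · subst h
    have : (fun r : ℝ => max r 0 ^ 2) =O[𝓝 0] fun r => ‖r - 0‖ ^ 2 := by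
      refine Asymptotics.IsBigO.of_bound 1 (Eventually.of_forall fun s => ?_)
      simp only [norm_pow, one_mul, sub_zero, norm_norm]
      gcongr
      rw [Real.norm_eq_abs, abs_of_nonneg (le_max_right _ _)]
      exact max_le (le_abs_self s) (abs_nonneg s)
    have := (this.hasFDerivAt one_lt_two).hasDerivAt
    simpa using this
  · rw [max_eq_left h.le]
    have := hasDerivAt_pow 2 r
    simp only [Nat.cast_ofNat, Nat.add_one_sub_one, pow_one] at this
    refine this.congr_of_eventuallyEq ?_
    filter_upwards [Ioi_mem_nhds h] with s hs
    rw [max_eq_left (le_of_lt hs)]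

/-- Summation by parts. -/
theorem sum_Icc_mul_sub_eq (a v : ℕ → ℝ) {n : ℕ} (hn : 1 ≤ n) (ha : a 1 = 0) :
    ∑ i ∈ Finset.Icc 2 n, a i * (v (i - 1) - v i) =
      ∑ i ∈ Finset.Icc 1 n, v i * (a (i + 1) - a i) - a (n + 1) * v n := by
  induction n, hn using Nat.le_induction with
  | base => simp [ha]; ring
  | succ n hn ih =>
    rw [Finset.sum_Icc_succ_top (by omega), Finset.sum_Icc_succ_top (by omega), ih]
    simp only [Nat.add_sub_cancel]
    ring

namespace CruiseControl.Params

variable {P : Params}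

theorem isOpen_OmegaS : IsOpen P.OmegaS := by
  unfold OmegaS
  simp only [ofPred_and, ofPred_forall]
  refine (isOpen_iInter_of_finite fun i => ?_).inter
    ((isOpen_iInter_of_finite fun i => ?_).inter (isOpen_iInter_of_finite fun i => ?_))
  · exact isOpen_lt continuous_const (by fun_prop)
  · exact isOpen_lt (by fun_prop) continuous_const
  · exact isOpen_lt continuous_const (by fun_prop)

theorem vel_mem {x : P.State} (hx : x ∈ P.OmegaS) {i : ℕ} (hi : i ∈ Finset.Icc 1 P.n) :
    P.vel x i ∈ Ioo 0 P.vmax := by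
  simp only [vel, dif_pos hi]
  exact ⟨hx.2.2 _, hx.2.1 _⟩

/-- The spacing `s_i`, with value `lam` for `i = 1` and `i = n + 1`. -/
def spacing (x : P.State) (i : ℕ) : ℝ :=
  if h : i ∈ Finset.Icc 2 P.n then x.1 ⟨i, h⟩ else P.lam

theorem dV_one (x : P.State) : P.dV x 1 = 0 := by simp [dV]

theorem dV_add_one (x : P.State) : P.dV x (P.n + 1) = 0 := by simp [dV]

/-- The part of the kinetic energy of a vehicle of speed `v` and desired speed `y` due to
over-speeding (`σ = 1`) or under-speeding (`σ = -1`). -/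
def halfEnergy (P : Params) (σ v y : ℝ) : ℝ :=
  P.vmax ^ 2 * max (σ * (v - y)) 0 ^ 2 / (2 * ((P.vmax - v) * v))

/-- The total energy. -/
def energy (P : Params) (x : P.State) : ℝ :=
  ∑ i ∈ Finset.Icc 1 P.n,
      (P.halfEnergy 1 (P.vel x i) (P.f x i) + P.halfEnergy (-1) (P.vel x i) (P.f x i)) +
    ∑ i ∈ Finset.Icc 2 P.n, P.V (spacing x i)

theorem halfEnergy_nonneg {σ v y : ℝ} (hv : v ∈ Ioo 0 P.vmax) : 0 ≤ P.halfEnergy σ v y := by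
  have := hv.1
  have := sub_pos.2 hv.2
  unfold halfEnergy
  positivity

/-- Because 2(vmax - v)v ≤ vmax², energy decay gives decay of the speed error itself. -/
theorem sq_max_le_halfEnergy {σ v y : ℝ} (hv : v ∈ Ioo 0 P.vmax) :
    max (σ * (v - y)) 0 ^ 2 ≤ P.halfEnergy σ v y := by
  have h1 := hv.1
  have h2 := sub_pos.2 hv.2
  unfold halfEnergy
  rw [le_div_iff₀ (by positivity), mul_comm]
  gcongr
  nlinarith [sq_nonneg (P.vmax - v), sq_nonneg v]

theorem beta_pos {v y : ℝ} (hv : v ∈ Ioo 0 P.vmax) (hy : y ∈ Ioo 0 P.vmax) :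
    0 < P.beta v y := by
  have h1 := hv.1
  have h2 := sub_pos.2 hv.2
  have h3 := hy.1
  have h4 := sub_pos.2 hy.2
  have h5 : 0 < P.vmax := h1.trans hv.2
  unfold beta
  refine div_pos ?_ (by positivity)
  have : P.vmax ^ 3 * (v + y) - 2 * P.vmax ^ 2 * y * v =
      P.vmax ^ 2 * (v * (P.vmax - y) + y * (P.vmax - v)) := by ring
  rw [this]
  positivity

/-- The partial derivative of vmax²(v - y)²/(2(vmax - v)v) in v is (v - y) β(v, y), and the feedback
is solved for β v'. The contribution of y' cancels, leaving the damping and the force a - c. -/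
theorem hasDerivWithinAt_halfEnergy {σ : ℝ} {v y : ℝ → ℝ}
    {v' y' a c t : ℝ} {I : Set ℝ} (hv : HasDerivWithinAt v v' I t)
    (hy : HasDerivWithinAt y y' I t) (hvt : v t ∈ Ioo 0 P.vmax) (hyt : y t ∈ Ioo 0 P.vmax)
    (hv' : v' = 1 / P.beta (v t) (y t) *
      ((P.vmax ^ 2 * y' - P.mu * P.vmax ^ 2 * (v t - y t)) / (v t * (P.vmax - v t)) + a - c)) :
    HasDerivWithinAt (fun τ => P.halfEnergy σ (v τ) (y τ))
      (-2 * P.mu * P.halfEnergy σ (v t) (y t) - σ * max (σ * (v t - y t)) 0 * (c - a)) I t := by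
  have h1 := hvt.1
  have h2 := sub_pos.2 hvt.2
  have hβ := beta_pos hvt hyt
  have hw : HasDerivWithinAt (fun τ => max (σ * (v τ - y τ)) 0 ^ 2)
      (2 * max (σ * (v t - y t)) 0 * (σ * (v' - y'))) I t :=
    HasDerivAt.comp_hasDerivWithinAt (h₂ := fun r => max r 0 ^ 2)
      (h := fun τ => σ * (v τ - y τ)) t (hasDerivAt_max_zero_sq _) ((hv.sub hy).const_mul σ)
  have hden : HasDerivWithinAt (fun τ => 2 * ((P.vmax - v τ) * v τ))
      (2 * (-v' * v t + (P.vmax - v t) * v')) I t :=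
    ((hv.const_sub P.vmax).mul hv).const_mul 2
  have := (hw.const_mul (P.vmax ^ 2)).div hden (by positivity)
  refine this.congr_deriv ?_
  have hβv : P.beta (v t) (y t) * v' =
      (P.vmax ^ 2 * y' - P.mu * P.vmax ^ 2 * (v t - y t)) / (v t * (P.vmax - v t)) + a - c := by
    rw [hv']
    field_simp
  have hsq : max (σ * (v t - y t)) 0 ^ 2 = max (σ * (v t - y t)) 0 * (σ * (v t - y t)) := by
    rcases le_total (σ * (v t - y t)) 0 with h | h
    · rw [max_eq_right h]; ring
    · rw [max_eq_left h]; ring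
  unfold halfEnergy
  rw [hsq]
  generalize max (σ * (v t - y t)) 0 = w
  have key : σ * w * (P.beta (v t) (y t) * v' - P.vmax ^ 2 * y' / (v t * (P.vmax - v t))) =
      -2 * P.mu * (P.vmax ^ 2 * (w * (σ * (v t - y t))) / (2 * ((P.vmax - v t) * v t))) -
        σ * w * (c - a) := by
    rw [hβv]
    field_simp
    ring
  rw [← key]
  unfold beta
  field_simp
  ring

/-- The vector field of the closed-loop system. -/
def field (P : Params) (x : P.State) : P.State :=
  (fun i => P.vel x (i - 1) - P.vel x i, fun i => P.F x i)

/-! ### Regularity of the data and of the vector field. -/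

section Admissible

variable (hP : P.Admissible)
include hP

theorem contDiffOn_deriv_V : ContDiffOn ℝ 2 (deriv P.V) (Ioi P.L) :=
  hP.V_contDiffOn.deriv_of_isOpen isOpen_Ioi (by norm_num)

theorem contDiffOn_deriv2_V : ContDiffOn ℝ 1 (deriv (deriv P.V)) (Ioi P.L) :=
  (contDiffOn_deriv_V hP).deriv_of_isOpen isOpen_Ioi (by norm_num)

theorem hasDerivAt_V {s : ℝ} (hs : P.L < s) : HasDerivAt P.V (deriv P.V s) s :=
  ((hP.V_contDiffOn.contDiffAt (Ioi_mem_nhds hs)).differentiableAt (by norm_num)).hasDerivAt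

theorem hasDerivAt_deriv_V {s : ℝ} (hs : P.L < s) :
    HasDerivAt (deriv P.V) (deriv (deriv P.V) s) s :=
  (((contDiffOn_deriv_V hP).contDiffAt (Ioi_mem_nhds hs)).differentiableAt
    (by norm_num)).hasDerivAt

theorem deriv_V_eq_zero {s : ℝ} (hs : P.lam ≤ s) : deriv P.V s = 0 := by
  -- At `lam` itself V is known to vanish only to the right, so the derivative is read off
  -- one-sidedly.
  have h1 := (hasDerivAt_V hP (hP.L_lt_lam.trans_le hs)).hasDerivWithinAt (s := Ici s)
  have h2 : HasDerivWithinAt P.V 0 (Ici s) s :=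
    (hasDerivWithinAt_const s (Ici s) (0 : ℝ)).congr
      (fun r hr => hP.V_eq_zero r (hs.trans hr)) (hP.V_eq_zero s hs)
  exact (uniqueDiffOn_Ici s s self_mem_Ici).eq_deriv _ h1 h2

theorem deriv_V_nonpos {s : ℝ} (hs : P.L < s) : deriv P.V s ≤ 0 := by
  rcases lt_or_ge s P.lam with h | h
  · exact (hP.V_deriv_neg s ⟨hs, h⟩).le
  · exact (deriv_V_eq_zero hP h).le

theorem L_lt_spacing {x : P.State} (hx : x ∈ P.OmegaS) (i : ℕ) : P.L < spacing x i := by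
  unfold spacing
  split_ifs
  · exact hx.1 _
  · exact hP.L_lt_lam

/-- The default spacing `lam` is chosen because V' vanishes there; the convention at the two ends
then needs no separate case. -/
theorem dV_eq (x : P.State) (i : ℕ) : P.dV x i = deriv P.V (spacing x i) := by
  unfold dV spacing
  split_ifs
  · rfl
  · exact (deriv_V_eq_zero hP le_rfl).symm

theorem dV_nonpos {x : P.State} (hx : x ∈ P.OmegaS) (i : ℕ) : P.dV x i ≤ 0 := by
  rw [dV_eq hP]
  exact deriv_V_nonpos hP (L_lt_spacing hP hx i)

theorem f_mem (x : P.State) (i : ℕ) : P.f x i ∈ Ioo 0 P.vmax := by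
  have := hP.b_mem (P.dV x (i + 1) - P.dV x i)
  constructor <;> unfold f <;> linarith [this.1, this.2]

theorem contDiffOn_dV (i : ℕ) : ContDiffOn ℝ 1 (fun x => P.dV x i) P.OmegaS := by
  unfold dV
  split_ifs with h
  · exact ((contDiffOn_deriv_V hP).of_le (by norm_num)).comp
      (f := fun x : P.State => x.1 ⟨i, h⟩) (by fun_prop) fun x hx => hx.1 _
  · exact contDiffOn_const

theorem contDiffOn_ddV (i : ℕ) : ContDiffOn ℝ 1 (fun x => P.ddV x i) P.OmegaS := by
  unfold ddV
  split_ifs with h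
  · exact (contDiffOn_deriv2_V hP).comp
      (f := fun x : P.State => x.1 ⟨i, h⟩) (by fun_prop) fun x hx => hx.1 _
  · exact contDiffOn_const

omit hP in
theorem contDiff_vel (i : ℕ) : ContDiff ℝ 1 (fun x => P.vel x i) := by
  unfold vel
  split_ifs with h
  · fun_prop
  · exact contDiff_const

omit hP in
theorem continuous_spacing (i : ℕ) : Continuous (fun x : P.State => spacing x i) := by
  unfold spacing
  split_ifs with h
  · fun_prop
  · exact continuous_const

theorem contDiffOn_f (i : ℕ) : ContDiffOn ℝ 1 (fun x => P.f x i) P.OmegaS :=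
  contDiffOn_const.sub ((hP.b_contDiff.of_le (by norm_num)).comp_contDiffOn
    ((contDiffOn_dV hP _).sub (contDiffOn_dV hP _)))

theorem contDiffOn_Z (i : ℕ) : ContDiffOn ℝ 1 (fun x => P.Z x i) P.OmegaS := by
  have hb : ContDiff ℝ 1 (deriv P.b) :=
    ((contDiff_succ_iff_deriv (n := 1)).1 (hP.b_contDiff.of_le (by norm_num))).2.2
  have h0 := (contDiff_vel (P := P) (i - 1)).contDiffOn (s := P.OmegaS)
  have h1 := (contDiff_vel (P := P) i).contDiffOn (s := P.OmegaS)
  have h2 := (contDiff_vel (P := P) (i + 1)).contDiffOn (s := P.OmegaS)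
  exact (contDiffOn_const.mul (hb.comp_contDiffOn
    ((contDiffOn_dV hP _).sub (contDiffOn_dV hP _)))).mul
    (((contDiffOn_ddV hP _).mul (h1.sub h2)).sub ((contDiffOn_ddV hP _).mul (h0.sub h1)))

theorem contDiffOn_F {i : ℕ} (hi : i ∈ Finset.Icc 1 P.n) :
    ContDiffOn ℝ 1 (fun x => P.F x i) P.OmegaS := by
  have hv := (contDiff_vel (P := P) i).contDiffOn (s := P.OmegaS)
  have hf := contDiffOn_f hP i
  have hβ : ContDiffOn ℝ 1 (fun x => P.beta (P.vel x i) (P.f x i)) P.OmegaS := by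
    refine ContDiffOn.div (by fun_prop) (by fun_prop) fun x hx => ?_
    have h := vel_mem hx hi
    have h1 := h.1
    have h2 := sub_pos.2 h.2
    positivity
  refine (contDiffOn_const.div hβ fun x hx => (beta_pos (vel_mem hx hi) (f_mem hP x i)).ne').mul
    (((ContDiffOn.div ((contDiffOn_Z hP i).sub (by fun_prop)) (by fun_prop) fun x hx => ?_).add
      (contDiffOn_dV hP _)).sub (contDiffOn_dV hP _))
  have h := vel_mem hx hi
  exact (mul_pos h.1 (sub_pos.2 h.2)).ne'

theorem continuousOn_energy : ContinuousOn P.energy P.OmegaS := by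
  refine ContinuousOn.add (continuousOn_finsetSum _ fun i hi => ?_)
    (continuousOn_finsetSum _ fun i hi => ?_)
  · have hv := (contDiff_vel (P := P) i).continuous.continuousOn (s := P.OmegaS)
    have hf := (contDiffOn_f hP i).continuousOn
    have key : ∀ σ : ℝ, ContinuousOn (fun x => P.halfEnergy σ (P.vel x i) (P.f x i)) P.OmegaS := by
      intro σ
      refine ContinuousOn.div (by fun_prop) (by fun_prop) fun x hx => ?_
      have h := vel_mem hx hi
      have h1 := h.1
      have h2 := sub_pos.2 h.2
      positivity
    exact (key 1).add (key (-1))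
  · exact hP.V_contDiffOn.continuousOn.comp (continuous_spacing i).continuousOn
      fun x hx => L_lt_spacing hP hx i

theorem contDiffOn_field : ContDiffOn ℝ 1 P.field P.OmegaS := by
  refine ContDiffOn.prodMk (contDiffOn_pi.2 fun i => ?_) (contDiffOn_pi.2 fun i => ?_)
  · exact ((contDiff_vel _).sub (contDiff_vel _)).contDiffOn
  · exact contDiffOn_F hP i.2

end Admissible

end CruiseControl.Params

/-! ### Scalar differential inequalities and pointwise consequences of an energy bound. -/

theorem hasDerivWithinAt_Icc_image_le {g g' : ℝ → ℝ} {a b : ℝ} (hab : a ≤ b)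
    (hg : ∀ t ∈ Icc a b, HasDerivWithinAt g (g' t) (Icc a b) t)
    (hg' : ∀ t ∈ Ioo a b, g' t ≤ 0) : g b ≤ g a := by
  refine antitoneOn_of_hasDerivWithinAt_nonpos (f' := g') (convex_Icc a b)
    (fun t ht => (hg t ht).continuousWithinAt) (fun t ht => ?_) (fun t ht => ?_)
    (left_mem_Icc.2 hab) (right_mem_Icc.2 hab) hab
  · exact (hg t (interior_subset ht)).mono interior_subset
  · rw [interior_Icc] at ht
    exact hg' t ht

/-- Decay of a function satisfying `g' ≤ -k g`. -/
theorem mul_exp_le_of_hasDerivWithinAt_le {g g' : ℝ → ℝ} {a b k : ℝ} (hab : a ≤ b)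
    (hg : ∀ t ∈ Icc a b, HasDerivWithinAt g (g' t) (Icc a b) t)
    (hg' : ∀ t ∈ Ioo a b, g' t ≤ -k * g t) : g b * Real.exp (k * (b - a)) ≤ g a := by
  have hexp : ∀ t, HasDerivAt (fun t => Real.exp (k * (t - a))) (Real.exp (k * (t - a)) * k) t := by
    intro t
    have := (((hasDerivAt_id t).sub_const a).const_mul k).exp
    simpa using this
  have := hasDerivWithinAt_Icc_image_le hab
    (fun t ht => (hg t ht).mul (hexp t).hasDerivWithinAt) fun t ht => ?_
  · simpa using this
  · have h1 := hg' t ht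
    have h2 := Real.exp_pos (k * (t - a))
    nlinarith

theorem exists_last_le {g : ℝ → ℝ} {a b c : ℝ} (hab : a ≤ b) (hg : ContinuousOn g (Icc a b)) :
    ∃ t₀ ∈ Icc a b, g t₀ ≤ max c (g a) ∧ ∀ t ∈ Ioc t₀ b, c < g t := by
  by_cases h : ∃ t ∈ Icc a b, g t ≤ c
  · obtain ⟨t, ht, htc⟩ := h
    have hcl : IsClosed (Icc a b ∩ g ⁻¹' Iic c) := hg.preimage_isClosed_of_isClosed isClosed_Icc
      isClosed_Iic
    have hK : IsCompact (Icc a b ∩ g ⁻¹' Iic c) :=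
      isCompact_Icc.of_isClosed_subset hcl inter_subset_left
    obtain ⟨t₀, ht₀, hmax⟩ := hK.exists_isGreatest ⟨t, ht, htc⟩
    refine ⟨t₀, ht₀.1, le_max_of_le_left ht₀.2, fun s hs => ?_⟩
    by_contra! hsc
    exact absurd (hmax ⟨⟨ht₀.1.1.trans hs.1.le, hs.2⟩, hsc⟩) (not_le.2 hs.1)
  · push Not at h
    exact ⟨a, left_mem_Icc.2 hab, le_max_right _ _, fun t ht => h t ⟨ht.1.le, ht.2⟩⟩

namespace CruiseControl.Params

variable {P : Params}

theorem Icc_subset_timeInterval {T : EReal} {a t : ℝ} (ha : 0 ≤ a) (ht : t ∈ timeInterval T) :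
    Icc a t ⊆ timeInterval T := fun _ hs =>
  ⟨ha.trans hs.1, lt_of_le_of_lt (EReal.coe_le_coe_iff.2 hs.2) ht.2⟩

theorem halfEnergy_le_energy (hP : P.Admissible) {x : P.State} (hx : x ∈ P.OmegaS) {i : ℕ}
    (hi : i ∈ Finset.Icc 1 P.n) :
    P.halfEnergy 1 (P.vel x i) (P.f x i) + P.halfEnergy (-1) (P.vel x i) (P.f x i) ≤
      P.energy x := by
  have h1 := Finset.single_le_sum (f := fun i => P.halfEnergy 1 (P.vel x i) (P.f x i) +
    P.halfEnergy (-1) (P.vel x i) (P.f x i)) (fun j hj => add_nonneg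
      (halfEnergy_nonneg (vel_mem hx hj)) (halfEnergy_nonneg (vel_mem hx hj))) hi
  have h2 : 0 ≤ ∑ i ∈ Finset.Icc 2 P.n, P.V (spacing x i) :=
    Finset.sum_nonneg fun j _ => hP.V_nonneg _ (L_lt_spacing hP hx j)
  unfold energy
  exact h1.trans (le_add_of_nonneg_right h2)

theorem V_le_energy (hP : P.Admissible) {x : P.State} (hx : x ∈ P.OmegaS) {i : ℕ}
    (hi : i ∈ Finset.Icc 2 P.n) : P.V (spacing x i) ≤ P.energy x := by
  have h1 := Finset.single_le_sum (f := fun i => P.V (spacing x i))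
    (fun j _ => hP.V_nonneg _ (L_lt_spacing hP hx j)) hi
  refine h1.trans (le_add_of_nonneg_left (Finset.sum_nonneg fun j hj => add_nonneg
      (halfEnergy_nonneg (vel_mem hx hj)) (halfEnergy_nonneg (vel_mem hx hj))))

/-- If v < c/2, the speed error is at least c/2 while the denominator is at most 2 vmax v, so a
small v forces a large energy. Using M + 1 keeps the divisor positive when M = 0. -/
theorem le_vel_of_halfEnergy_le {v y c M : ℝ} (hv : v ∈ Ioo 0 P.vmax) (hc : 0 < c) (hy : c ≤ y)
    (hM : 0 ≤ M) (h : P.halfEnergy (-1) v y ≤ M) :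
    min (c / 2) (P.vmax * c ^ 2 / (8 * (M + 1))) ≤ v := by
  have h1 := hv.1
  have h2 := sub_pos.2 hv.2
  have h3 : 0 < P.vmax := h1.trans hv.2
  rcases le_or_gt (c / 2) v with hcv | hcv
  · exact min_le_of_left_le hcv
  · refine min_le_of_right_le ?_
    unfold halfEnergy at h
    rw [div_le_iff₀ (by positivity)] at h
    have hm : c / 2 ≤ max (-1 * (v - y)) 0 := le_max_of_le_left (by linarith)
    have hm2 : (c / 2) ^ 2 ≤ max (-1 * (v - y)) 0 ^ 2 := by gcongr
    have h4 : P.vmax ^ 2 * (c / 2) ^ 2 ≤ M * (2 * (P.vmax * v)) := by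
      refine (mul_le_mul_of_nonneg_left hm2 (by positivity)).trans (h.trans ?_)
      gcongr
      linarith
    have h5 : P.vmax * (P.vmax * c ^ 2) ≤ P.vmax * (8 * M * v) := by linarith
    have h6 := le_of_mul_le_mul_left h5 h3
    rw [div_le_iff₀ (by positivity)]
    linarith

/-- The symmetry v ↦ vmax - v exchanges over-speeding and under-speeding, which turns the lower
speed bound into the upper one. -/
theorem halfEnergy_reflect (v y : ℝ) :
    P.halfEnergy (-1) (P.vmax - v) (P.vmax - y) = P.halfEnergy 1 v y := by
  unfold halfEnergy
  congr 2
  · congr 2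
    ring
  · ring

theorem vel_le_of_halfEnergy_le {v y c M : ℝ} (hv : v ∈ Ioo 0 P.vmax) (hc : 0 < c)
    (hy : y ≤ P.vmax - c) (hM : 0 ≤ M) (h : P.halfEnergy 1 v y ≤ M) :
    v ≤ P.vmax - min (c / 2) (P.vmax * c ^ 2 / (8 * (M + 1))) := by
  rw [← halfEnergy_reflect] at h
  have := le_vel_of_halfEnergy_le (P := P) (v := P.vmax - v)
    ⟨by linarith [hv.2], by linarith [hv.1]⟩ hc (by linarith) hM h
  linarith

/-! ### Energy decay and spacing bounds along solutions. -/

section Solution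

variable {T : EReal} {x : ℝ → P.State} (hx : P.IsSolution T x)
include hx

theorem hasDerivWithinAt_spacing {t : ℝ} (ht : t ∈ timeInterval T) {i : ℕ}
    (hi : i ∈ Finset.Icc 2 P.n) :
    HasDerivWithinAt (fun τ => spacing (x τ) i) (P.vel (x t) (i - 1) - P.vel (x t) i)
      (timeInterval T) t := by
  simp only [spacing, dif_pos hi]
  exact hx.deriv_s t ht ⟨i, hi⟩

theorem hasDerivWithinAt_vel {t : ℝ} (ht : t ∈ timeInterval T) {i : ℕ}
    (hi : i ∈ Finset.Icc 1 P.n) :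
    HasDerivWithinAt (fun τ => P.vel (x τ) i) (P.F (x t) i) (timeInterval T) t := by
  have := hx.deriv_v t ht ⟨i, hi⟩
  simp only [vel, dif_pos hi]
  exact this

variable (hP : P.Admissible)
include hP

theorem hasDerivWithinAt_dV {t : ℝ} (ht : t ∈ timeInterval T) (i : ℕ) :
    HasDerivWithinAt (fun τ => P.dV (x τ) i)
      (P.ddV (x t) i * (P.vel (x t) (i - 1) - P.vel (x t) i)) (timeInterval T) t := by
  by_cases hi : i ∈ Finset.Icc 2 P.n
  · simp only [dV, ddV, dif_pos hi]
    exact HasDerivAt.comp_hasDerivWithinAt (h₂ := deriv P.V) (h := fun τ => (x τ).1 ⟨i, hi⟩) t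
      (hasDerivAt_deriv_V hP ((hx.mem t ht).1 _)) (hx.deriv_s t ht ⟨i, hi⟩)
  · simp only [dV, ddV, dif_neg hi, zero_mul]
    exact hasDerivWithinAt_const _ _ _

/-- This identifies the viscosity term as the feedforward of the moving desired speed. -/
theorem hasDerivWithinAt_f {t : ℝ} (ht : t ∈ timeInterval T) (i : ℕ) :
    HasDerivWithinAt (fun τ => P.f (x τ) i) (P.Z (x t) i / P.vmax ^ 2) (timeInterval T) t := by
  have hvm : P.vmax ≠ 0 := (hP.vstar_pos.trans hP.vstar_lt_vmax).ne'
  have hb : HasDerivAt P.b (deriv P.b (P.dV (x t) (i + 1) - P.dV (x t) i))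
      (P.dV (x t) (i + 1) - P.dV (x t) i) :=
    (hP.b_contDiff.differentiable (by norm_num) _).hasDerivAt
  have := (HasDerivAt.comp_hasDerivWithinAt (h := fun τ => P.dV (x τ) (i + 1) - P.dV (x τ) i) t hb
    ((hasDerivWithinAt_dV hx hP ht (i + 1)).sub (hasDerivWithinAt_dV hx hP ht i))).const_sub P.vstar
  refine this.congr_deriv ?_
  simp only [Z, Nat.add_sub_cancel]
  field_simp

theorem hasDerivWithinAt_halfEnergy_solution (σ : ℝ) {t : ℝ}
    (ht : t ∈ timeInterval T) {i : ℕ} (hi : i ∈ Finset.Icc 1 P.n) :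
    HasDerivWithinAt (fun τ => P.halfEnergy σ (P.vel (x τ) i) (P.f (x τ) i))
      (-2 * P.mu * P.halfEnergy σ (P.vel (x t) i) (P.f (x t) i) -
        σ * max (σ * (P.vel (x t) i - P.f (x t) i)) 0 * (P.dV (x t) (i + 1) - P.dV (x t) i))
      (timeInterval T) t := by
  have hvm : P.vmax ≠ 0 := (hP.vstar_pos.trans hP.vstar_lt_vmax).ne'
  refine hasDerivWithinAt_halfEnergy (hasDerivWithinAt_vel hx ht hi)
    (hasDerivWithinAt_f hx hP ht i) (vel_mem (hx.mem t ht) hi) (f_mem hP _ i) ?_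
  rw [mul_div_cancel₀ _ (pow_ne_zero 2 hvm)]
  rfl

theorem energy_le_energy_zero {t : ℝ} (ht : t ∈ timeInterval T) :
    P.energy (x t) ≤ P.energy (x 0) := by
  have hsub := Icc_subset_timeInterval le_rfl ht
  refine hasDerivWithinAt_Icc_image_le (g := fun τ => P.energy (x τ)) ht.1 (fun τ hτ =>
    ((HasDerivWithinAt.fun_sum fun i hi =>
      (hasDerivWithinAt_halfEnergy_solution hx hP 1 (hsub hτ) hi).add
        (hasDerivWithinAt_halfEnergy_solution hx hP (-1) (hsub hτ) hi)).add
      (HasDerivWithinAt.fun_sum fun i hi =>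
        HasDerivAt.comp_hasDerivWithinAt (h₂ := P.V) (h := fun τ => spacing (x τ) i) τ
          (hasDerivAt_V hP (L_lt_spacing hP (hx.mem τ (hsub hτ)) i))
          (hasDerivWithinAt_spacing hx (hsub hτ) hi))).mono hsub) fun τ hτ => ?_
  have hτI := hsub (Ioo_subset_Icc_self hτ)
  have hn : 1 ≤ P.n := one_le_two.trans hP.two_le_n
  have hparts := sum_Icc_mul_sub_eq (P.dV (x τ)) (P.vel (x τ)) hn (dV_one _)
  -- With constant speed `vstar` the summation by parts says that the force differences sum to zero;
  -- it suffices to bound each summand by `vstar` times its difference.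
  have htel := sum_Icc_mul_sub_eq (P.dV (x τ)) (fun _ => P.vstar) hn (dV_one _)
  simp only [sub_self, mul_zero, Finset.sum_const_zero, dV_add_one, zero_mul, sub_zero]
    at hparts htel
  simp only [← dV_eq hP]
  rw [hparts, ← Finset.sum_add_distrib]
  refine (Finset.sum_le_sum fun i hi => ?_).trans_eq htel.symm
  have hv := vel_mem (hx.mem τ hτI) hi
  have h1 := mul_nonneg hP.mu_pos.le
    (halfEnergy_nonneg (P := P) (σ := 1) (y := P.f (x τ) i) hv)
  have h2 := mul_nonneg hP.mu_pos.le
    (halfEnergy_nonneg (P := P) (σ := -1) (y := P.f (x τ) i) hv)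
  have hmax : max (1 * (P.vel (x τ) i - P.f (x τ) i)) 0 -
      max (-1 * (P.vel (x τ) i - P.f (x τ) i)) 0 = P.vel (x τ) i - P.f (x τ) i := by
    rw [one_mul, neg_one_mul]
    exact max_zero_sub_max_neg_zero_eq_self _
  have hd : 0 ≤ (P.dV (x τ) (i + 1) - P.dV (x τ) i) *
      P.b (P.dV (x τ) (i + 1) - P.dV (x τ) i) := by
    rcases eq_or_ne (P.dV (x τ) (i + 1) - P.dV (x τ) i) 0 with h | h
    · rw [h, zero_mul]
    · exact (hP.b_sign _ h).le
  have hf : P.f (x τ) i = P.vstar - P.b (P.dV (x τ) (i + 1) - P.dV (x τ) i) := rfl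
  have key : (max (1 * (P.vel (x τ) i - P.f (x τ) i)) 0 -
      max (-1 * (P.vel (x τ) i - P.f (x τ) i)) 0) * (P.dV (x τ) (i + 1) - P.dV (x τ) i) =
      (P.vel (x τ) i - P.vstar) * (P.dV (x τ) (i + 1) - P.dV (x τ) i) +
      (P.dV (x τ) (i + 1) - P.dV (x τ) i) * P.b (P.dV (x τ) (i + 1) - P.dV (x τ) i) := by
    rw [hmax, hf]
    ring
  linarith

/-- If the force on a vehicle opposes the sign `σ` of its speed error, then the error in the
direction `σ` decays exponentially. -/
theorem max_le_exp {σ : ℝ} (hσ : σ = 1 ∨ σ = -1) {i : ℕ} (hi : i ∈ Finset.Icc 1 P.n) {a t M : ℝ}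
    (ha : 0 ≤ a) (hat : a ≤ t) (ht : t ∈ timeInterval T) (hM : P.energy (x 0) ≤ M)
    (hd : ∀ τ ∈ Ioo a t, 0 ≤ σ * (P.dV (x τ) (i + 1) - P.dV (x τ) i)) :
    max (σ * (P.vel (x t) i - P.f (x t) i)) 0 ≤ √M * Real.exp (-P.mu * (t - a)) := by
  have hsub := Icc_subset_timeInterval ha ht
  have haI := hsub (left_mem_Icc.2 hat)
  have hdecay := mul_exp_le_of_hasDerivWithinAt_le (k := 2 * P.mu) hat (fun τ hτ =>
    (hasDerivWithinAt_halfEnergy_solution hx hP σ (hsub hτ) hi).mono hsub) fun τ hτ => by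
      have := mul_nonneg (le_max_right (σ * (P.vel (x τ) i - P.f (x τ) i)) 0) (hd τ hτ)
      linarith
  have hsum := (halfEnergy_le_energy hP (hx.mem a haI) hi).trans
    ((energy_le_energy_zero hx hP haI).trans hM)
  have hva := vel_mem (hx.mem a haI) hi
  have hp := halfEnergy_nonneg (σ := 1) (y := P.f (x a) i) hva
  have hm := halfEnergy_nonneg (σ := -1) (y := P.f (x a) i) hva
  have hle : P.halfEnergy σ (P.vel (x a) i) (P.f (x a) i) ≤ M := by
    rcases hσ with rfl | rfl <;> linarith
  have hM0 : 0 ≤ M := by linarith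
  have hexp : Real.exp (-P.mu * (t - a)) ^ 2 * Real.exp (2 * P.mu * (t - a)) = 1 := by
    rw [← Real.exp_nat_mul, ← Real.exp_add, Real.exp_eq_one_iff]
    push_cast
    ring
  have hsq := sq_max_le_halfEnergy (σ := σ) (y := P.f (x t) i) (vel_mem (hx.mem t ht) hi)
  refine le_of_sq_le_sq (hsq.trans ?_) (by positivity)
  rw [mul_pow, Real.sq_sqrt hM0]
  calc P.halfEnergy σ (P.vel (x t) i) (P.f (x t) i)
      = P.halfEnergy σ (P.vel (x t) i) (P.f (x t) i) * Real.exp (2 * P.mu * (t - a)) *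
        Real.exp (-P.mu * (t - a)) ^ 2 := by rw [mul_assoc, mul_comm (Real.exp _), hexp, mul_one]
    _ ≤ M * Real.exp (-P.mu * (t - a)) ^ 2 := by
      gcongr
      exact hdecay.trans hle

/-- Only the time since the spacing last was at most `lam` matters; from then on the gap opens at a
rate at most 2√M exp(-μ(t - a)), whose integral is at most 2√M/μ whatever the length of the
interval. -/
theorem spacing_le {t M : ℝ} (ht : t ∈ timeInterval T) (hM : P.energy (x 0) ≤ M) {i : ℕ}
    (hi : i ∈ Finset.Icc 2 P.n) :
    spacing (x t) i ≤ max P.lam (spacing (x 0) i) + 2 * √M / P.mu := by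
  have hμ := hP.mu_pos
  have hsub := Icc_subset_timeInterval le_rfl ht
  obtain ⟨a, ha, hsa, hlam⟩ := exists_last_le (g := fun τ => spacing (x τ) i) (c := P.lam) ht.1
    fun τ hτ => ((hasDerivWithinAt_spacing hx (hsub hτ) hi).mono hsub).continuousWithinAt
  have hsub' := Icc_subset_timeInterval ha.1 ht
  obtain ⟨hi2, hin⟩ := Finset.mem_Icc.1 hi
  have hi1 : i ∈ Finset.Icc 1 P.n := Finset.mem_Icc.2 ⟨by omega, hin⟩
  have hip : i - 1 ∈ Finset.Icc 1 P.n := Finset.mem_Icc.2 ⟨by omega, by omega⟩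
  have hii : i - 1 + 1 = i := by omega
  have hdV : ∀ τ ∈ Ioc a t, P.dV (x τ) i = 0 := fun τ hτ => by
    rw [dV_eq hP, deriv_V_eq_zero hP (hlam τ hτ).le]
  -- Minus an antiderivative of the bound on the relative speed; added to the spacing it gives a
  -- non-increasing function.
  have hexp : ∀ τ, HasDerivAt (fun τ => 2 * √M / P.mu * Real.exp (-P.mu * (τ - a)))
      (-(2 * √M * Real.exp (-P.mu * (τ - a)))) τ := by
    intro τ
    have := ((((hasDerivAt_id τ).sub_const a).const_mul (-P.mu)).exp).const_mul (2 * √M / P.mu)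
    refine this.congr_deriv ?_
    simp only [id]
    field_simp
  have hle := hasDerivWithinAt_Icc_image_le ha.2 (fun τ hτ =>
    ((hasDerivWithinAt_spacing hx (hsub' hτ) hi).mono hsub').add (hexp τ).hasDerivWithinAt)
    fun τ hτ => by
      have hτI := hsub' (Ioo_subset_Icc_self hτ)
      have hτmem := hx.mem τ hτI
      have hd : ∀ r ∈ Ioo a τ, P.dV (x r) i = 0 := fun r hr =>
        hdV r ⟨hr.1, hr.2.le.trans hτ.2.le⟩
      have hneg : ∀ r ∈ Ioo a τ, ∀ j, P.dV (x r) j ≤ 0 := fun r hr j =>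
        dV_nonpos hP (hx.mem r (hsub' ⟨hr.1.le, hr.2.le.trans hτ.2.le⟩)) j
      have h1 := max_le_exp hx hP (Or.inl rfl) hip ha.1 hτ.1.le hτI hM fun r hr => by
        rw [hii, hd r hr]
        linarith [hneg r hr (i - 1)]
      have h2 := max_le_exp hx hP (Or.inr rfl) hi1 ha.1 hτ.1.le hτI hM fun r hr => by
        rw [hd r hr]
        linarith [hneg r hr (i + 1)]
      -- The vehicle in front wants to go no faster than the one behind: V'(s_i) = 0, V' ≤ 0
      -- elsewhere, and b is monotone.
      have h3 : P.f (x τ) (i - 1) ≤ P.f (x τ) i := by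
        unfold f
        rw [hii, hdV τ ⟨hτ.1, hτ.2.le⟩]
        have := hP.b_mono (show P.dV (x τ) (i + 1) - 0 ≤ 0 - P.dV (x τ) (i - 1) by
          linarith [dV_nonpos hP hτmem (i + 1), dV_nonpos hP hτmem (i - 1)])
        linarith
      linarith [le_max_left (1 * (P.vel (x τ) (i - 1) - P.f (x τ) (i - 1))) 0,
        le_max_left (-1 * (P.vel (x τ) i - P.f (x τ) i)) 0]
  have hpos : 0 ≤ 2 * √M / P.mu * Real.exp (-P.mu * (t - a)) := by positivity
  have h0 : Real.exp (-P.mu * (a - a)) = 1 := by simp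
  simp only [Pi.add_apply] at hle
  rw [h0, mul_one] at hle
  linarith

omit hP in
theorem hasDerivWithinAt_field {t : ℝ} (ht : t ∈ timeInterval T) :
    HasDerivWithinAt x (P.field (x t)) (timeInterval T) t :=
  (hasDerivWithinAt_pi.2 fun i => hx.deriv_s t ht i).prodMk
    (hasDerivWithinAt_pi.2 fun i => hx.deriv_v t ht i)

end Solution

/-! ### Maximal solutions and the invariant compact box. -/

theorem isSolution_of_hasDerivWithinAt_field {T : EReal} (hT : 0 < T) {x : ℝ → P.State}
    (hmem : ∀ t ∈ timeInterval T, x t ∈ P.OmegaS)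
    (hx : ∀ t ∈ timeInterval T, HasDerivWithinAt x (P.field (x t)) (timeInterval T) t) :
    P.IsSolution T x where
  T_pos := hT
  mem := hmem
  deriv_s t ht i := hasDerivWithinAt_pi.1 ((hasFDerivAt_fst (𝕜 := ℝ)).comp_hasDerivWithinAt t
    (hx t ht)) i
  deriv_v t ht i := hasDerivWithinAt_pi.1 ((hasFDerivAt_snd (𝕜 := ℝ)).comp_hasDerivWithinAt t
    (hx t ht)) i

theorem timeInterval_coe (T : ℝ) : timeInterval (T : EReal) = Ico 0 T := by
  ext t
  simp [timeInterval]

theorem IsMaximalSolution.eq_top_of_mem_compact (hP : P.Admissible) {T : EReal}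
    {x : ℝ → P.State} (hx : P.IsMaximalSolution T x) {K : Set P.State} (hK : IsCompact K)
    (hKO : K ⊆ P.OmegaS) (hxK : ∀ t ∈ timeInterval T, x t ∈ K) : T = ⊤ := by
  by_contra hT
  have hpos := hx.1.T_pos
  lift T to ℝ using ⟨hT, (bot_lt_of_lt hpos).ne'⟩
  have hder := fun t => hasDerivWithinAt_field hx.1 (t := t)
  rw [timeInterval_coe] at hxK hder
  obtain ⟨T', hTT', y, hyx, hy⟩ := exists_extension_of_mem_compact isOpen_OmegaS
    (contDiffOn_field hP) hK hKO (EReal.coe_pos.1 hpos) hder hxK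
  refine hx.2 T' y (EReal.coe_lt_coe_iff.2 hTT') ?_ (by rwa [timeInterval_coe])
  refine isSolution_of_hasDerivWithinAt_field (hpos.trans (EReal.coe_lt_coe_iff.2 hTT'))
    (fun t ht => ?_) fun t ht => ?_
  · rw [timeInterval_coe] at ht
    exact (hy t ht).1
  · rw [timeInterval_coe] at ht ⊢
    exact (hy t ht).2

/-- The compact boxes in the state space. -/
def box (P : Params) (u B η : ℝ) : Set P.State :=
  (univ.pi fun _ => Icc u B) ×ˢ (univ.pi fun _ => Icc η (P.vmax - η))

theorem isCompact_box (u B η : ℝ) : IsCompact (P.box u B η) :=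
  (isCompact_univ_pi fun _ => isCompact_Icc).prod (isCompact_univ_pi fun _ => isCompact_Icc)

theorem box_subset {u B η : ℝ} (hu : P.L < u) (hη : 0 < η) : P.box u B η ⊆ P.OmegaS :=
  fun x hx => ⟨fun i => hu.trans_le (hx.1 i trivial).1,
    fun i => (hx.2 i trivial).2.trans_lt (by linarith), fun i => hη.trans_le (hx.2 i trivial).1⟩

theorem exists_box (hP : P.Admissible) {S : Set P.State} (hS : IsCompact S)
    (hSO : S ⊆ P.OmegaS) :
    ∃ u B η : ℝ, P.L < u ∧ 0 < η ∧ ∀ (T : EReal) (x : ℝ → P.State), P.IsSolution T x → x 0 ∈ S →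
      ∀ t ∈ timeInterval T, x t ∈ P.box u B η := by
  obtain ⟨M', hM'⟩ := hS.bddAbove_image ((continuousOn_energy hP).mono hSO)
  obtain ⟨R, hR⟩ := hS.isBounded.exists_norm_le
  set M := max M' 0
  have hM0 : 0 ≤ M := le_max_right _ _
  obtain ⟨u, hu, hVu⟩ := mem_nhdsGT_iff_exists_Ioo_subset.1
    (hP.V_tendsto.eventually_gt_atTop M)
  have hle_of_V : ∀ s, P.L < s → P.V s ≤ M → u ≤ s := fun s hs hVs => by
    by_contra! hsu
    exact absurd (hVu ⟨hs, hsu⟩) (not_lt.2 hVs)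
  set B := max P.lam R + 2 * √M / P.mu
  have hB : 0 ≤ 2 * √M / P.mu := div_nonneg (by positivity) hP.mu_pos.le
  obtain ⟨D, hD⟩ := isCompact_Icc.exists_bound_of_continuousOn (s := Icc u B)
    ((contDiffOn_deriv_V hP).continuousOn.mono fun s hs => lt_of_lt_of_le hu hs.1)
  -- Force differences lie in [-2D, 2D], so by monotonicity of b this is a margin between the
  -- desired speeds and both 0 and vmax.
  set c := min (P.vstar - P.b (2 * D)) (P.vmax - P.vstar + P.b (-(2 * D)))
  have hc : 0 < c := lt_min (by linarith [(hP.b_mem (2 * D)).2])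
    (by linarith [(hP.b_mem (-(2 * D))).1])
  have hvm : 0 < P.vmax := hP.vstar_pos.trans hP.vstar_lt_vmax
  refine ⟨u, B, min (c / 2) (P.vmax * c ^ 2 / (8 * (M + 1))), hu, by positivity,
    fun T x hx h0 t ht => ?_⟩
  have hE0 : P.energy (x 0) ≤ M := (hM' (mem_image_of_mem _ h0)).trans (le_max_left _ _)
  have hE : P.energy (x t) ≤ M := (energy_le_energy_zero hx hP ht).trans hE0
  have hmem := hx.mem t ht
  have hs : ∀ i, spacing (x t) i ∈ Icc u B := by
    intro i
    by_cases hi : i ∈ Finset.Icc 2 P.n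
    · refine ⟨hle_of_V _ (L_lt_spacing hP hmem i) ((V_le_energy hP hmem hi).trans hE),
        (spacing_le hx hP ht hE0 hi).trans ?_⟩
      have : spacing (x 0) i ≤ R := by
        rw [spacing, dif_pos hi]
        exact (Real.le_norm_self _).trans
          ((norm_le_pi_norm (x 0).1 ⟨i, hi⟩).trans ((norm_fst_le _).trans (hR _ h0)))
      exact add_le_add (max_le_max le_rfl this) le_rfl
    · rw [spacing, dif_neg hi]
      exact ⟨hle_of_V _ hP.L_lt_lam (by rw [hP.V_eq_zero _ le_rfl]; exact hM0),
        le_add_of_le_of_nonneg (le_max_left _ _) hB⟩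
  have hf : ∀ i, c ≤ P.f (x t) i ∧ P.f (x t) i ≤ P.vmax - c := by
    intro i
    have h1 := abs_le.1 (hD _ (hs i))
    have h2 := abs_le.1 (hD _ (hs (i + 1)))
    rw [← dV_eq hP] at h1 h2
    have h3 := hP.b_mono (show P.dV (x t) (i + 1) - P.dV (x t) i ≤ 2 * D by linarith)
    have h4 := hP.b_mono (show -(2 * D) ≤ P.dV (x t) (i + 1) - P.dV (x t) i by linarith)
    have h5 : c ≤ P.vstar - P.b (2 * D) := min_le_left _ _
    have h6 : c ≤ P.vmax - P.vstar + P.b (-(2 * D)) := min_le_right _ _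
    constructor <;> unfold f <;> linarith
  refine ⟨fun i _ => ?_, fun i _ => ?_⟩
  · have := hs i
    rwa [spacing, dif_pos i.2] at this
  · have hv := vel_mem hmem i.2
    have hH := (halfEnergy_le_energy hP hmem i.2).trans hE
    have h1 := le_vel_of_halfEnergy_le hv hc (hf i).1 hM0
      (by linarith [halfEnergy_nonneg (σ := 1) (y := P.f (x t) i) hv])
    have h2 := vel_le_of_halfEnergy_le hv hc (hf i).2 hM0
      (by linarith [halfEnergy_nonneg (σ := -1) (y := P.f (x t) i) hv])
    rw [vel, dif_pos i.2] at h1 h2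
    exact ⟨h1, h2⟩

end CruiseControl.Params

end

theorem corollary1 (P : CruiseControl.Params) (hP : P.Admissible)
    (S : Set P.State) (hS : IsCompact S) (hSO : S ⊆ P.OmegaS) :
    ∃ K : Set P.State, IsCompact K ∧ K ⊆ P.OmegaS ∧
      ∀ (T : EReal) (x : ℝ → P.State), P.IsSolution T x → x 0 ∈ S →
        (∀ t ∈ CruiseControl.Params.timeInterval T, x t ∈ K) ∧
        (P.IsMaximalSolution T x → T = ⊤) := by
  obtain ⟨u, B, η, hu, hη, hbox⟩ := CruiseControl.Params.exists_box hP hS hSO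
  refine ⟨P.box u B η, CruiseControl.Params.isCompact_box u B η,
    CruiseControl.Params.box_subset hu hη, fun T x hx h0 => ⟨hbox T x hx h0, fun hmax => ?_⟩⟩
  exact hmax.eq_top_of_mem_compact hP (CruiseControl.Params.isCompact_box u B η)
    (CruiseControl.Params.box_subset hu hη) (hbox T x hx h0)
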